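/- Let $A$ be a finite set with at least two elements. An \emph{$A$-generated group} is a group $G$ together with a map $\varphi:A\to G$ (not necessarily injective) such that $\varphi(A)$ generates $G$; for $w$ in the free group $F$ on $A$ (viewed as a reduced word over $A\cup A^{-1}$), $[w]_G$ denotes its value in $G$. The Cayley graph $\Gamma(G)$ has vertex set $G$ and edge set $G\times(A\cup A^{-1})$, where the edge $(g,a)$ goes from $g$ to $g[a]_G$ and has inverse edge $(g[a]_G,a^{-1})$; subgraphs are closed under inversion of edges. A \emph{constellation} in $\Gamma(G)$ is a triple $(\Xi,g,\Theta)$ with $g\in G$ and $\Xi,\Theta$ connected subgraphs of $\Gamma(G)$, both containing the vertices $1$ and $g$, such that $1$ and $g$ lie in distinct connected components of $\Xi\cap\Theta$. An $A$-generated group $H$ is a \emph{predissolver} of $G$ if, for every constellation $(\Xi,g,\Theta)$ in $\Gamma(G)$, one has $[u]_H\neq[v]_H$ for all $u,v\in F$ such that $[u]_G=g=[v]_G$ and the paths in $\Gamma(G)$ starting at $1$ and labeled $u$ and $v$ run entirely in $\Xi$ and in $\Theta$, respectively. A predissolver $H$ of $G$ is a \emph{dissolver} of $G$ if moreover there is a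 morphism $H\to G$ compatible with the maps from $A$. For $A$-generated groups $(H,\psi)$ and $(G,\varphi)$, let $H\times_A G$ be the subgroup of $H\times G$ generated by the elements $(\psi(a),\varphi(a))$, $a\in A$; it is $A$-generated via $a\mapsto(\psi(a),\varphi(a))$. \textbf{Theorem.} For every finite $A$-generated group $G$ there exists a positive integer $N\ge|G|$ such that for every $m\ge N$ the following hold. \begin{enumerate} \item There is a map $\psi:A\to\mathbb{A}_m$ to the alternating group of degree $m$ which makes $\mathbb{A}_m$ an $A$-generated group that is a predissolver of $G$. \item For every $\psi$ as in (1), the product $\mathbb{A}_m\times_A G$ is a dissolver of $G$, and the kernel of the projection of $\mathbb{A}_m\times_A G$ onto $G$ is $\mathbb{A}_m$ (that is, it equals $\mathbb{A}_m\times\{1\}$). The group $\mathbb{A}_m$ is generated by two elements. \end{enumerate} -/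

import Mathlib

/-- A graph in the sense of Serre: `E` is the set of all (oriented) edges, each geometric edge being
a pair consisting of an edge and its inverse; loops and multiple edges are allowed. -/
structure SerreGraph (V : Type*) (E : Type*) where
  src : E → V
  tgt : E → V
  inv : E → E
  inv_inv : ∀ e, inv (inv e) = e
  inv_ne : ∀ e, inv e ≠ e
  src_inv : ∀ e, src (inv e) = tgt e
  tgt_inv : ∀ e, tgt (inv e) = src e

namespace SerreGraph

variable {V E : Type*} (Γ : SerreGraph V E)

/-- `p` is a path (sequence of consecutive edges) from `u` to `v`; the empty path is allowed. -/
def IsPath : V → List E → V → Prop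
  | u, [], v => u = v
  | u, e :: p, v => Γ.src e = u ∧ IsPath (Γ.tgt e) p v

/-- A subgraph: a set of vertices and a set of edges, the latter closed under inversion and having
its end points among the former. -/
structure Subgraph where
  verts : Set V
  edges : Set E
  inv_mem : ∀ e ∈ edges, Γ.inv e ∈ edges
  src_mem : ∀ e ∈ edges, Γ.src e ∈ verts

namespace Subgraph

variable {Γ}

/-- The intersection of two subgraphs. -/
def inter (Ξ Θ : Γ.Subgraph) : Γ.Subgraph where
  verts := Ξ.verts ∩ Θ.verts
  edges := Ξ.edges ∩ Θ.edges
  inv_mem := fun e he => ⟨Ξ.inv_mem e he.1, Θ.inv_mem e he.2⟩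
  src_mem := fun e he => ⟨Ξ.src_mem e he.1, Θ.src_mem e he.2⟩

/-- The vertices `u`, `v` of `Δ` can be joined by a path inside `Δ`, that is, they lie in the same
connected component of `Δ`. -/
def Joined (Δ : Γ.Subgraph) (u v : V) : Prop :=
  u ∈ Δ.verts ∧ v ∈ Δ.verts ∧ ∃ p : List E, Γ.IsPath u p v ∧ ∀ e ∈ p, e ∈ Δ.edges

/-- Any two vertices of `Δ` can be joined by a path inside `Δ`. -/
def Connected (Δ : Γ.Subgraph) : Prop :=
  ∀ u ∈ Δ.verts, ∀ v ∈ Δ.verts, Δ.Joined u v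

end Subgraph

/-- `(Ξ, g, Θ)` is a constellation in the graph `Γ` with distinguished vertex `o`. -/
structure IsConstellation (o : V) (Ξ : Γ.Subgraph) (g : V) (Θ : Γ.Subgraph) : Prop where
  left_connected : Ξ.Connected
  right_connected : Θ.Connected
  base_mem : o ∈ (Ξ.inter Θ).verts
  vertex_mem : g ∈ (Ξ.inter Θ).verts
  not_joined : ¬ (Ξ.inter Θ).Joined o g

end SerreGraph

namespace AGenerated

variable {A G H : Type*} [Group G] [Group H]

/-- `(G, φ)` is an `A`-generated group: `G` is generated by `φ(A)` (`φ` need not be injective). -/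
def IsGenerated (φ : A → G) : Prop :=
  Subgroup.closure (Set.range φ) = ⊤

/-- The value in `G` of a letter of `A ∪ A⁻¹`; as in `FreeGroup`, `(a, true)` stands for `a` and
`(a, false)` for the formal inverse of `a`. -/
def letter (φ : A → G) (x : A × Bool) : G :=
  cond x.2 (φ x.1) (φ x.1)⁻¹

/-- The value `[w]_G` in `G` of a word `w` of the free group on `A`. -/
def value (φ : A → G) (w : FreeGroup A) : G :=
  FreeGroup.lift φ w

/-- The Cayley graph of `(G, φ)`: the edge `(g, x)` goes from `g` to `g * x`. -/
def cayley (φ : A → G) : SerreGraph G (G × (A × Bool)) where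
  src := fun e => e.1
  tgt := fun e => e.1 * letter φ e.2
  inv := fun e => (e.1 * letter φ e.2, (e.2.1, !e.2.2))
  inv_inv := by rintro ⟨g, a, b⟩; cases b <;> simp [letter]
  inv_ne := by rintro ⟨g, a, b⟩ h; cases b <;> simp at h
  src_inv := fun _ => rfl
  tgt_inv := by rintro ⟨g, a, b⟩; cases b <;> simp [letter]

/-- The path in the Cayley graph which starts at `g` and is labeled by the given word. -/
def pathFrom (φ : A → G) : G → List (A × Bool) → List (G × (A × Bool))
  | _, [] => []
  | g, x :: w => (g, x) :: pathFrom φ (g * letter φ x) w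

/-- The path in the Cayley graph labeled by (the reduced word representing) `w` and starting at `1`
runs entirely in the subgraph `Δ`. -/
def RunsIn (φ : A → G) (w : FreeGroup A) (Δ : (cayley φ).Subgraph) : Prop :=
  open Classical in (1 : G) ∈ Δ.verts ∧ ∀ e ∈ pathFrom φ 1 w.toWord, e ∈ Δ.edges

/-- `(H, ψ)` dissolves the constellation `(Ξ, g, Θ)` of the Cayley graph of `(G, φ)`. -/
def Dissolves (φ : A → G) (ψ : A → H) (Ξ : (cayley φ).Subgraph) (g : G)
    (Θ : (cayley φ).Subgraph) : Prop :=
  ∀ u v : FreeGroup A, value φ u = g → value φ v = g → RunsIn φ u Ξ → RunsIn φ v Θ →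
    value ψ u ≠ value ψ v

/-- `(H, ψ)` is a predissolver of `(G, φ)`: it is an `A`-generated group which dissolves every
constellation of the Cayley graph of `(G, φ)`. -/
def IsPredissolver (φ : A → G) (ψ : A → H) : Prop :=
  IsGenerated ψ ∧ ∀ (Ξ : (cayley φ).Subgraph) (g : G) (Θ : (cayley φ).Subgraph),
    (cayley φ).IsConstellation 1 Ξ g Θ → Dissolves φ ψ Ξ g Θ

/-- `(H, ψ)` is a dissolver of `(G, φ)`: a predissolver with a morphism of `A`-generated groups
onto `(G, φ)`. -/
def IsDissolver (φ : A → G) (ψ : A → H) : Prop :=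
  IsPredissolver φ ψ ∧ ∃ χ : H →* G, ∀ a, χ (ψ a) = φ a

/-- The underlying group of the product of the `A`-generated groups `(H, ψ)` and `(G, φ)`. -/
def prod (ψ : A → H) (φ : A → G) : Subgroup (H × G) :=
  Subgroup.closure (Set.range fun a => (ψ a, φ a))

/-- The generating map of the product. -/
def prodMap (ψ : A → H) (φ : A → G) (a : A) : prod ψ φ :=
  ⟨(ψ a, φ a), Subgroup.subset_closure ⟨a, rfl⟩⟩

/-- The projection of the product onto its second factor. -/
def prodSnd (ψ : A → H) (φ : A → G) : prod ψ φ →* G :=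
  (MonoidHom.snd H G).comp (prod ψ φ).subtype

end AGenerated

/-! For each constellation, glue Ξ and Θ along the component of 1 in Ξ ∩ Θ. In the resulting graph
each letter is a partial injection, and the two copies of g stay distinct. If H acts on a set
containing this graph, letters acting along reversed edges, then [u]_H sends the left copy of g to
the base vertex and [v]_H sends the right copy there, so the two values differ
(`dissolves_of_isConstellation`).

It remains to extend the partial injections of all the finitely many glued graphs, taken together,
to generators of the alternating group of any large degree (`exists_generating_extension`). The
obstruction is a nonempty set of vertices on which every letter is already a permutation. There is
none: it would cover the Cayley graph with a single sheet and so identify the two copies of g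
(`eq_empty_of_closed_of_isConstellation`). Every vertex can therefore be linked to one long cycle.
Suitable powers of two generators isolate this cycle and a shorter one, whose commutator is a
3-cycle; the group is primitive, and Jordan's theorem applies.

The kernel is found by a Goursat argument: its image in the simple group A_m is normal, and A_m is
too large for that image to be trivial. -/

namespace AlternatingExtension

open Equiv Equiv.Perm

/-! ### Permutation groups containing a long cycle and a 3-cycle -/

theorem val_swap_mul_swap {n k : ℕ} (hk : 1 ≤ k) (hkn : k + 1 ≤ n) (x : Fin (n + 1)) :
    (((swap 0 ⟨1, by lia⟩ * swap 0 ⟨k + 1, by lia⟩ : Perm (Fin (n + 1))) x : Fin (n + 1)) : ℕ) =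
      if (x : ℕ) = 0 then k + 1 else if (x : ℕ) = k + 1 then 1 else
        if (x : ℕ) = 1 then 0 else x := by
  simp only [Perm.mul_apply, swap_apply_def, Fin.ext_iff, Fin.val_zero]
  split_ifs <;> simp_all

theorem fin_add_one_induction {n : ℕ} {p : Fin (n + 1) → Prop} (zero : p 0)
    (add_one : ∀ z, p z → p (z + 1)) (z : Fin (n + 1)) : p z := by
  induction z using Fin.induction with
  | zero => exact zero
  | succ i ih => rw [← Fin.coeSucc_eq_succ]; exact add_one _ ih

/-- Conjugating the cycle `(0 1 … k)` by the full rotation changes it by a `3`-cycle. -/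
theorem finRotate_mul_cycleRange {n k : ℕ} (hk : 1 ≤ k) (hkn : k + 1 ≤ n) :
    finRotate (n + 1) * Fin.cycleRange (⟨k, by lia⟩ : Fin (n + 1)) =
      (swap 0 ⟨1, by lia⟩ * swap 0 ⟨k + 1, by lia⟩) *
        (Fin.cycleRange (⟨k, by lia⟩ : Fin (n + 1)) * finRotate (n + 1)) := by
  have hrot : ∀ y : Fin (n + 1), ((finRotate (n + 1) y : Fin (n + 1)) : ℕ) =
      if (y : ℕ) = n then 0 else (y : ℕ) + 1 := by
    intro y
    rw [coe_finRotate]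
    simp only [Fin.ext_iff, Fin.val_last]
  have hcyc : ∀ y : Fin (n + 1), ((Fin.cycleRange (⟨k, by lia⟩ : Fin (n + 1)) y : Fin (n + 1)) : ℕ)
      = if (y : ℕ) < k then (y : ℕ) + 1 else if (y : ℕ) = k then 0 else y := by
    intro y
    split_ifs with h1 h2
    · rw [Fin.coe_cycleRange_of_lt h1]
    · rw [Fin.cycleRange_of_eq (Fin.ext h2)]; simp
    · rw [Fin.cycleRange_of_gt]; rw [Fin.lt_def]; simp; lia
  ext x
  have hx := x.2
  rw [Perm.mul_apply (finRotate (n + 1)), Perm.mul_apply (_ * _), val_swap_mul_swap hk hkn,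
    Perm.mul_apply, hrot, hcyc, hcyc, hrot]
  grind

-- Conjugating the 3-cycle by the rotation gives 3-cycles `(z, z + q, z + 1)` for all `z`. A block
-- that meets such a triple and also contains a point fixed by its 3-cycle contains the whole
-- triple. A nontrivial block thus spreads over the rotated part, which is more than half of all
-- points.
open scoped Pointwise in
theorem isPreprimitive_of_finRotate_of_threeCycle {T : Type*} [Finite T] {n k : ℕ} (hk : 1 ≤ k)
    (hkn : 2 * k + 4 ≤ n) (hT : Nat.card T ≤ n)
    (H : Subgroup (Perm (T ⊕ Fin (n + 1)))) [MulAction.IsPretransitive H (T ⊕ Fin (n + 1))]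
    (hrot : Equiv.sumCongr (1 : Perm T) (finRotate (n + 1)) ∈ H)
    (hcyc : Equiv.sumCongr (1 : Perm T) (swap 0 ⟨1, by lia⟩ * swap 0 ⟨k + 1, by lia⟩) ∈ H) :
    MulAction.IsPreprimitive H (T ⊕ Fin (n + 1)) := by
  set q : Fin (n + 1) := ⟨k + 1, by lia⟩ with hq
  have hq' : (q : ℕ) = k + 1 := rfl
  have h1 : (⟨1, by lia⟩ : Fin (n + 1)) = 1 := by
    apply Fin.ext; simp [Nat.mod_eq_of_lt (show 1 < n + 1 by lia)]
  have hv1 : ((1 : Fin (n + 1)) : ℕ) = 1 := by rw [← h1]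
  have nev : ∀ x y : Fin (n + 1), (x : ℕ) + y < n + 1 → 0 < (x : ℕ) → x + y ≠ 0 := by
    intro x y hxy hx h
    have := congrArg Fin.val h
    rw [Fin.val_add, Nat.mod_eq_of_lt hxy] at this
    simp at this; lia
  have ne1 : (1 : Fin (n + 1)) ≠ 0 := by simpa using nev 1 0 (by simp; lia) (by lia)
  have neq : q ≠ 0 := by simpa using nev q 0 (by simp; lia) (by lia)
  have ne2 : (1 : Fin (n + 1)) + 1 ≠ 0 := nev _ _ (by lia) (by lia)
  have neqq : q + q ≠ 0 := nev _ _ (by lia) (by lia)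
  have neq1 : q + 1 ≠ 0 := nev _ _ (by lia) (by lia)
  have hs := val_swap_mul_swap (n := n) hk (by lia)
  rw [← hq] at hs
  have triple : ∀ z : Fin (n + 1), ∃ h ∈ H, h (.inr z) = .inr (z + q) ∧
      h (.inr (z + q)) = .inr (z + 1) ∧
      ∀ w, w ≠ .inr z → w ≠ .inr (z + q) → w ≠ .inr (z + 1) → h w = w := by
    intro z
    induction z using fin_add_one_induction with
    | zero =>
      refine ⟨_, hcyc, ?_, ?_, ?_⟩
      · simp only [Equiv.sumCongr_apply, Sum.map_inr, Sum.inr.injEq, zero_add]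
        apply Fin.ext; rw [hs]; simp [hq']
      · simp only [Equiv.sumCongr_apply, Sum.map_inr, Sum.inr.injEq, zero_add]
        apply Fin.ext; rw [hs, if_neg (by simp [hq']), if_pos hq', hv1]
      · rintro (w | w)
        · simp
        · simp only [Equiv.sumCongr_apply, Sum.map_inr, Sum.inr.injEq, zero_add,
            ne_eq]
          intro a1 a2 a3
          apply Fin.ext
          rw [Fin.ext_iff] at a1 a2 a3
          rw [hs, if_neg (by simpa using a1), if_neg (by simpa using a2), if_neg (by lia)]
    | add_one j ih =>
      obtain ⟨h, hH, e1, e2, e3⟩ := ih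
      have hinv : (Equiv.sumCongr (1 : Perm T) (finRotate (n + 1)))⁻¹ =
          Equiv.sumCongr (1 : Perm T) (finRotate (n + 1))⁻¹ := by
        rw [sumCongr_inv]; simp
      have hr :  ∀ x : Fin (n + 1), (finRotate (n + 1))⁻¹ (x + 1) = x := by
        intro x; rw [← finRotate_apply, Perm.inv_def, Equiv.symm_apply_apply]
      refine ⟨_, H.mul_mem (H.mul_mem hrot hH) (H.inv_mem hrot), ?_, ?_, ?_⟩
      · simp only [Perm.mul_apply, hinv, Equiv.sumCongr_apply, Sum.map_inr, hr, e1, finRotate_apply]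
        congr 1; abel
      · rw [show j + 1 + q = j + q + 1 by abel]
        simp only [Perm.mul_apply, hinv, Equiv.sumCongr_apply, Sum.map_inr, hr, e2, finRotate_apply]
      · intro w w1 w2 w3
        obtain ⟨v, rfl⟩ := (Equiv.sumCongr (1 : Perm T) (finRotate (n + 1))).surjective w
        rw [Perm.mul_apply, Perm.mul_apply, Perm.inv_def, Equiv.symm_apply_apply]
        congr 1
        apply e3
        · rintro rfl; apply w1; simp
        · rintro rfl; apply w2; simp [add_right_comm]
        · rintro rfl; apply w3; simp
  apply MulAction.IsPreprimitive.of_isTrivialBlock_base (.inr 0)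
  intro B h0 hB
  by_cases hsub : B.Subsingleton
  · exact Or.inl hsub
  right
  have step : ∀ h ∈ H, ∀ w ∈ B, h w ∈ B → ∀ x ∈ B, h x ∈ B := by
    intro h hH w hw hw' x hx
    have : (⟨h, hH⟩ : H) • B = B :=
      hB.smul_eq_of_mem hw hw'
    rw [← this]
    exact Set.smul_mem_smul_set hx
  have grow : ∀ z, ∀ w ∈ B, Sum.inr z ∈ B → w ≠ .inr z → w ≠ .inr (z + q) → w ≠ .inr (z + 1) →
      Sum.inr (z + 1) ∈ B := by
    intro z w hw hz w1 w2 w3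
    obtain ⟨h, hH, e1, e2, e3⟩ := triple z
    have key := step h hH w hw (by rwa [e3 w w1 w2 w3])
    have := key _ hz
    rw [e1] at this
    have := key _ this
    rwa [e2] at this
  have start : ∃ z, Sum.inr z ∈ B ∧ Sum.inr (z + 1) ∈ B := by
    obtain ⟨y, hy, hy0⟩ : ∃ y ∈ B, y ≠ .inr 0 := by
      by_contra! hcon
      exact hsub fun x hx y hy => (hcon x hx).trans (hcon y hy).symm
    by_cases hy1 : y = .inr 1
    · exact ⟨0, h0, by simpa [hy1] using hy⟩
    -- The 3-cycle at `0` moves `q`, so the one at `q` is used instead; it fixes `0` because `2 * k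
    -- + 4 ≤ n` rules out wrap-around.
    by_cases hyq : y = .inr q
    · subst hyq
      refine ⟨q, hy, grow q _ h0 hy ?_ ?_ ?_⟩
      · simpa using neq.symm
      · simpa using neqq.symm
      · simpa using neq1.symm
    · exact ⟨0, h0, grow 0 y hy h0 hy0 (by simpa using hyq) (by simpa using hy1)⟩
  obtain ⟨z, hz, hz1⟩ := start
  have all : ∀ j : Fin (n + 1), Sum.inr (z + j) ∈ B ∧ Sum.inr (z + j + 1) ∈ B := by
    intro j
    induction j using fin_add_one_induction with
    | zero => simpa using ⟨hz, hz1⟩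
    | add_one j ih =>
      -- With consecutive points `x`, `x + 1` in the block, `x` is the fixed point for the 3-cycle
      -- at `x + 1`.
      rw [← add_assoc]
      refine ⟨ih.2, grow _ _ ih.1 ih.2 ?_ ?_ ?_⟩
      · simpa using ne1
      · rw [add_assoc _ 1 q, add_comm 1 q]; simpa using neq1
      · rw [add_assoc _ 1 1]; simpa using ne2
  have hZ : Set.range (Sum.inr : Fin (n + 1) → T ⊕ Fin (n + 1)) ⊆ B := by
    rintro _ ⟨x, rfl⟩
    simpa using (all (x - z)).1
  apply hB.eq_univ_of_card_lt
  have h2 := Set.ncard_le_ncard hZ (Set.toFinite B)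
  rw [← Set.image_univ, Set.ncard_image_of_injective _ Sum.inr_injective, Set.ncard_univ,
    Nat.card_eq_fintype_card, Fintype.card_fin] at h2
  rw [Nat.card_sum, Nat.card_eq_fintype_card (α := Fin (n + 1)), Fintype.card_fin]
  lia

end AlternatingExtension

/-! ### Generating the alternating group with prescribed values on `T` -/

namespace AlternatingExtension

open Equiv Equiv.Perm

theorem cycleRange_pow {n : ℕ} [NeZero n] (i : Fin n) : Fin.cycleRange i ^ ((i : ℕ) + 1) = 1 := by
  by_cases h0 : i = 0
  · simp [h0]
  · have h := lcm_cycleType (Fin.cycleRange i)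
    rw [Fin.cycleType_cycleRange h0, Multiset.lcm_singleton, normalize_eq] at h
    rw [h, pow_orderOf_eq_one]

theorem finRotate_pow (n : ℕ) : finRotate (n + 1) ^ (n + 1) = 1 := by
  simpa [Fin.cycleRange_last] using cycleRange_pow (Fin.last n)

/-- Let `b` act as `P` together with an `(n + 1)`-cycle, and `a` as `Q a` times a disjoint `(k +
1)`-cycle; since `P ^ n = 1` and `Q a ^ k = 1`, powers isolate the two cycles. Both have odd length,
hence are even permutations. The points of `T` not linked to the long cycle form a set that `hopen`
forces to be empty. -/
theorem exists_closure_eq_alternatingGroup {A T : Type*} [Fintype T] [DecidableEq T] {n k : ℕ}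
    (hk : 1 ≤ k) (hk2 : Even k) (hn : Even n) (hkn : 2 * k + 4 ≤ n)
    (hT : k + 2 * Fintype.card T ≤ n) {a b : A} (hab : a ≠ b)
    (P : Perm T) (hP : P ^ n = 1) (hPs : sign P = 1)
    (Q : A → Perm (T × Fin 3)) (hQ : Q a ^ k = 1) (hQs : ∀ c, sign (Q c) = 1)
    (hopen : ∀ S : Set T, (∀ t ∈ S, P t ∈ S) →
      (∀ c ≠ b, ∀ t ∈ S, ∃ t' ∈ S, Q c (t, 0) = (t', 0)) → S = ∅) :
    ∃ ψ : A → Perm (T ⊕ Fin (n + 1)),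
      Subgroup.closure (Set.range ψ) = alternatingGroup (T ⊕ Fin (n + 1)) ∧
      (∀ t, ψ b (.inl t) = .inl (P t)) ∧
      ∀ c ≠ b, ∀ t t', Q c (t, 0) = (t', 0) → ψ c (.inl t) = .inl t' := by
  classical
  -- Levels 1 and 2 of `T × Fin 3` are placed on the long cycle, beyond the points `0, …, k` of the
  -- short one. A point of `T` that leaves level 0 is thereby linked to the long cycle.
  obtain ⟨j⟩ : Nonempty (T × Fin 2 ↪ {x : Fin (n + 1) // k < (x : ℕ)}) := by
    apply Function.Embedding.nonempty_of_card_le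
    have : Fintype.card {x : Fin (n + 1) // k < (x : ℕ)} = n - k := by
      rw [Fintype.card_subtype]
      have : (Finset.univ.filter fun x : Fin (n + 1) => k < (x : ℕ)) =
          Finset.Ioi ⟨k, by lia⟩ := by
        ext x; simp [Fin.lt_def]
      rw [this, Fin.card_Ioi]; simp
    rw [this, Fintype.card_prod, Fintype.card_fin]; lia
  let e : T × Fin 3 ↪ T ⊕ Fin (n + 1) :=
    ⟨fun p => Fin.cases (.inl p.1) (fun i : Fin 2 => .inr (j (p.1, i))) p.2, by
      rintro ⟨t, i⟩ ⟨t', i'⟩ h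
      induction i using Fin.cases <;> induction i' using Fin.cases <;>
        simp_all [Subtype.val_inj]⟩
  have he0 : ∀ t, e (t, 0) = .inl t := fun t => rfl
  have hes : ∀ t (i : Fin 2), e (t, i.succ) = .inr (j (t, i)) := fun t i => rfl
  let γ : Perm (Fin (n + 1)) := Fin.cycleRange ⟨k, by lia⟩
  let γ' : Perm (T ⊕ Fin (n + 1)) := Equiv.sumCongr 1 γ
  let ψ : A → Perm (T ⊕ Fin (n + 1)) := fun c =>
    if c = b then Equiv.sumCongr P (finRotate (n + 1))
    else viaEmbeddingHom e (Q c) * if c = a then γ' else 1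
  have hψb : ψ b = Equiv.sumCongr P (finRotate (n + 1)) := if_pos rfl
  have hψa : ψ a = viaEmbeddingHom e (Q a) * γ' := by simp [ψ, hab]
  have hψt : ∀ c ≠ b, ∀ t, ψ c (.inl t) = e (Q c (t, 0)) := by
    intro c hc t
    have h : (if c = a then γ' else 1) (.inl t) = .inl t := by
      split_ifs <;> simp [γ']
    simp only [ψ, if_neg hc, Perm.mul_apply]
    rw [h, ← he0, viaEmbeddingHom_apply, viaEmbedding_apply]
  refine ⟨ψ, ?_, ?_, ?_⟩
  rotate_left
  · intro t; rw [hψb]; rfl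
  · intro c hc t t' h; rw [hψt c hc, h, he0]
  set H := Subgroup.closure (Set.range ψ) with hH
  have hmem : ∀ c, ψ c ∈ H := fun c => Subgroup.subset_closure ⟨c, rfl⟩
  apply le_antisymm
  · rw [hH, Subgroup.closure_le]
    rintro _ ⟨c, rfl⟩
    have hvia : sign (viaEmbeddingHom e (Q c)) = 1 := by
      rw [viaEmbeddingHom_apply, viaEmbedding, sign_extendDomain, hQs]
    have hγ : sign γ' = 1 := by
      simp [γ', γ, sign_sumCongr, Fin.sign_cycleRange, hk2.neg_one_pow]
    have hrot : sign (Equiv.sumCongr P (finRotate (n + 1))) = 1 := by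
      simp [sign_sumCongr, hPs, sign_finRotate, hn.neg_one_pow]
    simp only [SetLike.mem_coe, mem_alternatingGroup, ψ]
    split_ifs <;> simp [hvia, hγ, hrot]
  have hrotmem : Equiv.sumCongr (1 : Perm T) (finRotate (n + 1)) ∈ H := by
    have h1 : (ψ b) ^ n = (Equiv.sumCongr (1 : Perm T) (finRotate (n + 1)))⁻¹ := by
      have := map_pow (sumCongrHom T (Fin (n + 1))) (P, finRotate (n + 1)) n
      simp only [sumCongrHom_apply, Prod.pow_mk] at this
      have hr : finRotate (n + 1) ^ n = (finRotate (n + 1))⁻¹ :=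
        eq_inv_of_mul_eq_one_left (by rw [← pow_succ, finRotate_pow])
      rw [hψb, ← this, hP, hr, sumCongr_inv, inv_one]
    rw [← inv_inv (Equiv.sumCongr _ _), ← h1]
    exact H.inv_mem (H.pow_mem (hmem b) n)
  have hγmem : γ' ∈ H := by
    have h1 : (ψ a) ^ k = γ'⁻¹ := by
      have hcomm : Commute (viaEmbeddingHom e (Q a)) γ' := by
        apply Perm.Disjoint.commute
        intro x
        by_cases hx : x ∈ Set.range e
        · right
          obtain ⟨⟨t, i⟩, rfl⟩ := hx
          induction i using Fin.cases with
          | zero => rw [he0]; simp [γ']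
          | succ i =>
            rw [hes]
            simp only [γ', Equiv.sumCongr_apply, Sum.map_inr, Sum.inr.injEq, γ]
            apply Fin.cycleRange_of_gt
            exact (j (t, i)).2
        · left
          exact viaEmbedding_apply_of_notMem _ _ _ hx
      have hord : γ' ^ (k + 1) = 1 := by
        have := map_pow (sumCongrHom T (Fin (n + 1))) (1, γ) (k + 1)
        simp only [sumCongrHom_apply, Prod.pow_mk, one_pow] at this
        rw [← this, cycleRange_pow ⟨k, _⟩, sumCongr_one]
      rw [hψa, hcomm.mul_pow, ← map_pow, hQ, map_one, one_mul]
      exact eq_inv_of_mul_eq_one_left (by rw [← pow_succ, hord])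
    rw [← inv_inv γ', ← h1]
    exact H.inv_mem (H.pow_mem (hmem a) k)
  have hcyc : Equiv.sumCongr (1 : Perm T) (swap 0 ⟨1, by lia⟩ * swap 0 ⟨k + 1, by lia⟩) ∈ H := by
    have h1 := finRotate_mul_cycleRange (n := n) hk (by lia)
    rw [← mul_inv_eq_iff_eq_mul] at h1
    have h2 : Equiv.sumCongr (1 : Perm T) (swap 0 ⟨1, by lia⟩ * swap 0 ⟨k + 1, by lia⟩) =
        Equiv.sumCongr (1 : Perm T) (finRotate (n + 1)) * γ' *
          (γ' * Equiv.sumCongr (1 : Perm T) (finRotate (n + 1)))⁻¹ := by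
      simp only [γ', sumCongr_mul, sumCongr_inv, mul_one, inv_one, ← h1]
      rfl
    rw [h2]
    exact H.mul_mem (H.mul_mem hrotmem hγmem) (H.inv_mem (H.mul_mem hγmem hrotmem))
  have hrotorb : ∀ z : Fin (n + 1), (Sum.inr z : T ⊕ Fin (n + 1)) ∈
      MulAction.orbit H (Sum.inr 0 : T ⊕ Fin (n + 1)) := by
    intro z
    induction z using fin_add_one_induction with
    | zero => exact MulAction.mem_orbit_self _
    | add_one z ih =>
      have := MulAction.mem_orbit_of_mem_orbit (⟨_, hrotmem⟩ : H) ih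
      simpa [Subgroup.smul_def] using this
  have horb : ∀ h ∈ H, ∀ x, h x ∈ MulAction.orbit H (Sum.inr 0 : T ⊕ Fin (n + 1)) →
      x ∈ MulAction.orbit H (Sum.inr 0 : T ⊕ Fin (n + 1)) := by
    intro h hh x hx
    simpa [Subgroup.smul_def] using MulAction.mem_orbit_of_mem_orbit (⟨h, hh⟩⁻¹ : H) hx
  have htrans : MulAction.IsPretransitive H (T ⊕ Fin (n + 1)) := by
    rw [MulAction.isPretransitive_iff_base (.inr 0)]
    -- Points outside the orbit of the long cycle stay outside it, and a letter other than `b`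
    -- cannot move them off level 0.
    have hS := hopen {t | Sum.inl t ∉ MulAction.orbit H (Sum.inr 0 : T ⊕ Fin (n + 1))} ?_ ?_
    · rintro (t | z)
      · by_contra hcon
        exact (Set.eq_empty_iff_forall_notMem.1 hS) t hcon
      · exact hrotorb z
    · intro t ht ht'
      refine ht (horb _ (hmem b) _ ?_)
      rw [hψb]; exact ht'
    · intro c hc t ht
      obtain ⟨t', i, hti⟩ : ∃ t' i, Q c (t, 0) = (t', i) := ⟨_, _, rfl⟩
      have h1 := hψt c hc t
      rw [hti] at h1
      induction i using Fin.cases with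
      | zero =>
        refine ⟨t', fun h => ht (horb _ (hmem c) _ ?_), hti⟩
        rw [h1, he0]; exact h
      | succ i =>
        refine absurd (horb _ (hmem c) _ ?_) ht
        rw [h1, hes]; exact hrotorb _
  have hprim := isPreprimitive_of_finRotate_of_threeCycle hk hkn
    (by rw [Nat.card_eq_fintype_card]; lia) H hrotmem hcyc
  refine alternatingGroup_le_of_isPreprimitive_of_isThreeCycle_mem hprim (g := _) ?_ hcyc
  have h3 : Equiv.sumCongr (1 : Perm T) (swap (0 : Fin (n + 1)) ⟨1, by lia⟩ *
      swap 0 ⟨k + 1, by lia⟩) =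
      swap (.inr 0) (.inr ⟨1, by lia⟩) * swap (.inr 0) (.inr ⟨k + 1, by lia⟩) := by
    rw [← sumCongr_one_swap, ← sumCongr_one_swap, sumCongr_mul, one_mul]
  rw [h3]
  apply isThreeCycle_swap_mul_swap_same <;> simp [Fin.ext_iff]
  lia

end AlternatingExtension

/-! ### Extending partial injections to even permutations -/

namespace AlternatingExtension

open Equiv Equiv.Perm

/-- A partial injection of `T` extends to an even permutation of `T × Fin 3` which sends
every point of `T × {0}` outside the domain of the partial injection to a different level. -/
theorem exists_even_extension {T : Type*} [Fintype T] [DecidableEq T] (R : T → T → Prop)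
    (hfun : ∀ x y y', R x y → R x y' → y = y') (hinj : ∀ x x' y, R x y → R x' y → x = x') :
    ∃ Q : Perm (T × Fin 3), sign Q = 1 ∧ ∀ t t', Q (t, 0) = (t', 0) ↔ R t t' := by
  classical
  let f : {x // ∃ y, R x y} → T := Subtype.val
  let g : {x // ∃ y, R x y} → T := fun x => x.2.choose
  have hg : ∀ x : {x // ∃ y, R x y}, R x (g x) := fun x => x.2.choose_spec
  obtain ⟨P, hP⟩ := Equiv.Perm.exists_extending_pair f g Subtype.val_injective
    (fun x x' h => Subtype.ext (hinj _ _ _ (hg x) (h ▸ hg x')))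
  have hPR : ∀ x y, R x y → P x = y := fun x y h =>
    (hP ⟨x, y, h⟩).trans (hfun _ _ _ (hg _) h)
  -- `P` acts on two levels, so its sign cancels; the level rotations over points outside the domain
  -- are 3-cycles, hence even.
  refine ⟨prodCongrLeft (fun i : Fin 3 => if i = 2 then 1 else P) *
    prodCongrRight (fun t => if ∃ t', R t t' then 1 else finRotate 3), ?_, ?_⟩
  · rw [Perm.sign_mul, sign_prodCongrLeft, sign_prodCongrRight]
    have h3 : ∀ t, sign (if ∃ t', R t t' then 1 else finRotate 3) = 1 := by
      intro t; split_ifs <;> simp [sign_finRotate]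
    simp [h3, Fin.prod_univ_three]
  · intro t t'
    by_cases hex : ∃ t', R t t'
    · obtain ⟨y, hy⟩ := id hex
      simp only [Perm.mul_apply, prodCongrRight_apply, if_pos hex, prodCongrLeft_apply]
      simp only [Perm.one_apply, Fin.reduceEq, if_false, hPR t y hy, Prod.mk.injEq, and_true]
      exact ⟨fun h => h ▸ hy, fun h => hfun _ _ _ hy h⟩
    · refine iff_of_false ?_ fun h => hex ⟨t', h⟩
      simp [hex]

/-- A finite family of partial injections of a finite set, indexed by at least two letters and
such that no nonempty set of points is completely closed under it, extends, for every large `m`,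
to a generating family of the alternating group of degree `m`. -/
theorem exists_generating_extension {A Y : Type*} [Nontrivial A] [Finite Y]
    (R : A → Y → Y → Prop)
    (hfun : ∀ c x y y', R c x y → R c x y' → y = y')
    (hinj : ∀ c x x' y, R c x y → R c x' y → x = x')
    (hopen : ∀ S : Set Y, (∀ c, ∀ y ∈ S, ∃ y' ∈ S, R c y y') → S = ∅) :
    ∃ N : ℕ, ∀ m, N ≤ m → ∃ (ι : Y → Fin m) (ψ : A → alternatingGroup (Fin m)),
      Function.Injective ι ∧ Subgroup.closure (Set.range ψ) = ⊤ ∧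
      ∀ c x y, R c x y → (ψ c : Perm (Fin m)) (ι x) = ι y := by
  classical
  have := Fintype.ofFinite Y
  obtain ⟨a, b, hab⟩ := exists_pair_ne A
  obtain ⟨B, hB1, hB2⟩ := exists_even_extension (R b) (hfun b) (hinj b)
  set w := Fintype.card Y * 3 with hw
  -- `B` does not depend on `m`, so `K` and `k` are fixed before `m`. Any multiple `n` of `K` is
  -- even and satisfies `B ^ n = 1`.
  set K := 2 * orderOf B with hK
  have hKpos : 0 < K := by have := orderOf_pos B; lia
  -- `T` will have `w + r < w + K` points, so the order of `Q a` divides `k` for every `m`.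
  set k := ((w + K) * 3).factorial with hk
  have hkpos : 1 ≤ k := Nat.factorial_pos _
  have hkeven : Even k := even_iff_two_dvd.2 (Nat.dvd_factorial (by norm_num) (by lia))
  refine ⟨w + 1 + K + (2 * k + 4) + k + 2 * (w + K), fun m hm => ?_⟩
  set d := m - w - 1 with hd
  set r := d % K with hr
  set n := K * (d / K) with hn
  have hrK : r < K := Nat.mod_lt _ hKpos
  have hnr : n + r = d := Nat.div_add_mod d K
  have hneven : Even n := by rw [hn, hK, mul_assoc]; exact even_two_mul _
  -- The `r` padding points make the degree exactly `m`; they lie outside the domain of every `R'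
  -- c`.
  let T := (Y × Fin 3) ⊕ Fin r
  have hcardT : Fintype.card T = w + r := by simp [T, hw]
  have hinl : ∀ y z : Y, (Sum.inl (y, 0) : T) = Sum.inl (z, 0) → y = z := fun y z h =>
    congrArg Prod.fst (Sum.inl.inj h)
  let R' : A → T → T → Prop := fun c t t' =>
    ∃ y y', t = .inl (y, 0) ∧ t' = .inl (y', 0) ∧ R c y y'
  have hQ := fun c => exists_even_extension (R' c)
    (by
      rintro x t t' ⟨y, y', rfl, rfl, h⟩ ⟨z, z', hz, rfl, h'⟩
      obtain rfl : y = z := hinl _ _ hz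
      rw [hfun _ _ _ _ h h'])
    (by
      rintro x t t' ⟨y, y', rfl, rfl, h⟩ ⟨z, z', rfl, hz, h'⟩
      obtain rfl : y' = z' := hinl _ _ hz
      rw [hinj _ _ _ _ h h'])
  choose Q hQs hQR using hQ
  have hQk : Q a ^ k = 1 := by
    apply orderOf_dvd_iff_pow_eq_one.1
    refine (orderOf_dvd_card).trans ?_
    rw [Fintype.card_perm, Fintype.card_prod, hcardT, Fintype.card_fin]
    exact Nat.factorial_dvd_factorial (by gcongr)
  have hBn : (Equiv.sumCongr B (1 : Perm (Fin r))) ^ n = 1 := by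
    have := map_pow (sumCongrHom (Y × Fin 3) (Fin r)) (B, 1) n
    simp only [sumCongrHom_apply, Prod.pow_mk, one_pow] at this
    have hB : B ^ n = 1 := by
      rw [hn, hK, mul_comm 2, mul_assoc, pow_mul, pow_orderOf_eq_one, one_pow]
    rw [← this, hB, sumCongr_one]
  obtain ⟨ψ, hψ, hψb, hψc⟩ := exists_closure_eq_alternatingGroup hkpos hkeven hneven
    (by lia) (by rw [hcardT]; lia) hab (Equiv.sumCongr B (1 : Perm (Fin r))) hBn
    (by rw [sign_sumCongr, hB1, Perm.sign_one, one_mul]) Q hQk hQs (by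
      intro S hSb hSc
      -- The letter `a` alone expels the padding points and the levels 1 and 2 of `Y × Fin 3`, on
      -- which `b` need not leave the set.
      have h1 : ∀ t ∈ S, ∃ y, t = .inl (y, 0) := by
        intro t ht
        obtain ⟨t', -, h⟩ := hSc a hab t ht
        obtain ⟨y, -, rfl, -⟩ := (hQR _ _ _).1 h
        exact ⟨y, rfl⟩
      have h2 := hopen {y | Sum.inl (y, 0) ∈ S} (by
        intro c y hy
        by_cases hc : c = b
        · subst hc
          have h := hSb _ hy
          obtain ⟨y', hy'⟩ := h1 _ h
          have hBy : B (y, 0) = (y', 0) := by simpa using hy'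
          rw [hy'] at h
          exact ⟨y', h, (hB2 _ _).1 hBy⟩
        · obtain ⟨t', ht', h⟩ := hSc c hc _ hy
          obtain ⟨z, y', hz, rfl, hR⟩ := (hQR _ _ _).1 h
          obtain rfl : y = z := hinl _ _ hz
          exact ⟨y', ht', hR⟩)
      rw [Set.eq_empty_iff_forall_notMem] at h2 ⊢
      intro t ht
      obtain ⟨y, rfl⟩ := h1 t ht
      exact h2 y ht)
  have hcard : Fintype.card (T ⊕ Fin (n + 1)) = Fintype.card (Fin m) := by
    rw [Fintype.card_sum, hcardT, Fintype.card_fin, Fintype.card_fin]; lia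
  let e : T ⊕ Fin (n + 1) ≃ Fin m := Fintype.equivOfCardEq hcard
  have hmem : ∀ c, ψ c ∈ alternatingGroup (T ⊕ Fin (n + 1)) := fun c =>
    hψ ▸ Subgroup.subset_closure ⟨c, rfl⟩
  let ψ' : A → alternatingGroup (T ⊕ Fin (n + 1)) := fun c => ⟨ψ c, hmem c⟩
  have hψ' : Subgroup.closure (Set.range ψ') = ⊤ := by
    apply Subgroup.map_injective (alternatingGroup (T ⊕ Fin (n + 1))).subtype_injective
    rw [MonoidHom.map_closure, ← Set.range_comp, ← MonoidHom.range_eq_map, Subgroup.range_subtype]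
    exact hψ
  refine ⟨fun y => e (.inl (.inl (y, 0))), fun c => e.altCongrHom (ψ' c), ?_, ?_, ?_⟩
  · intro y y' h
    exact hinl _ _ (Sum.inl.inj (e.injective h))
  · have := congrArg (Subgroup.map e.altCongrHom.toMonoidHom) hψ'
    rw [MonoidHom.map_closure, ← Set.range_comp, Subgroup.map_top_of_surjective _
      e.altCongrHom.surjective] at this
    exact this
  · intro c x y h
    have h1 : ψ c (.inl (.inl (x, 0))) = .inl (.inl (y, 0)) := by
      by_cases hc : c = b
      · subst hc
        rw [hψb]
        simp [(hB2 x y).2 h]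
      · exact hψc c hc _ _ ((hQR c _ _).2 ⟨x, y, rfl, rfl, h⟩)
    simp [Equiv.altCongrHom_apply_coe, ψ', h1]

end AlternatingExtension

/-! ### Finiteness of the set of subgraphs, and joining along edges -/

namespace SerreGraph.Subgraph

variable {V E : Type*} {Γ : SerreGraph V E}

theorem verts_edges_injective :
    Function.Injective fun Δ : Γ.Subgraph => (Δ.verts, Δ.edges) := by
  rintro ⟨v, e, _, _⟩ ⟨v', e', _, _⟩ h
  simp only [Prod.mk.injEq] at h
  obtain ⟨rfl, rfl⟩ := h
  rfl

instance [Finite V] [Finite E] : Finite Γ.Subgraph :=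
  Finite.of_injective _ verts_edges_injective

theorem isPath_append_singleton {e : E} :
    ∀ {p : List E} {u : V}, Γ.IsPath u p (Γ.src e) → Γ.IsPath u (p ++ [e]) (Γ.tgt e)
  | [], _, h => ⟨h.symm, rfl⟩
  | _ :: _, _, h => ⟨h.1, isPath_append_singleton h.2⟩

theorem Joined.tgt {Δ : Γ.Subgraph} {u : V} {e : E} (h : Δ.Joined u (Γ.src e))
    (he : e ∈ Δ.edges) : Δ.Joined u (Γ.tgt e) := by
  obtain ⟨hu, -, p, hp, hpe⟩ := h
  refine ⟨hu, ?_, p ++ [e], isPath_append_singleton hp, ?_⟩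
  · rw [← Γ.src_inv]
    exact Δ.src_mem _ (Δ.inv_mem e he)
  · intro f hf
    rcases List.mem_append.1 hf with hf | hf
    · exact hpe f hf
    · rwa [List.mem_singleton.1 hf]

theorem Joined.src {Δ : Γ.Subgraph} {u : V} {e : E} (h : Δ.Joined u (Γ.tgt e))
    (he : e ∈ Δ.edges) : Δ.Joined u (Γ.src e) := by
  rw [← Γ.tgt_inv]
  exact Joined.tgt (by rwa [Γ.src_inv]) (Δ.inv_mem e he)

end SerreGraph.Subgraph

/-! ### Glued graphs of constellations and predissolvers -/

namespace AGenerated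

open SerreGraph Equiv

variable {A G H : Type*} [Group G] [Group H]

theorem induction_on_mul {φ : A → G} (hφ : IsGenerated φ) {p : G → Prop} (one : p 1)
    (mul : ∀ h c, p h → p (h * φ c)) (mul_inv : ∀ h c, p h → p (h * (φ c)⁻¹)) (g : G) : p g := by
  have hg : g ∈ Subgroup.closure (Set.range φ) := by rw [hφ]; trivial
  induction hg using Subgroup.closure_induction_right with
  | one => exact one
  | mul_right x _ y hy ih => obtain ⟨c, rfl⟩ := hy; exact mul _ _ ih
  | mul_inv_cancel x _ y hy ih => obtain ⟨c, rfl⟩ := hy; exact mul_inv _ _ ih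

theorem value_eq_prod (ψ : A → H) [DecidableEq A] (w : FreeGroup A) :
    value ψ w = (w.toWord.map (letter ψ)).prod := by
  conv_lhs => rw [← FreeGroup.mk_toWord (x := w)]
  rw [value, FreeGroup.lift_mk]
  rfl

section Gluing

variable (φ : A → G) (Ξ Θ : (cayley φ).Subgraph)

open Classical in
/-- The vertex lying over `h` of the sheet `Θ`, in the graph obtained from `Ξ` and `Θ` by glueing
them along the connected component of `1` in their intersection. -/
noncomputable def rightLift (h : G) : G × Bool := (h, decide ¬ (Ξ.inter Θ).Joined 1 h)

/-- The graph obtained from `Ξ` and `Θ` by glueing them along the connected component of `1` in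
their intersection has an edge labeled `c` from `p` to `q`. -/
def GluedEdge (c : A) (p q : G × Bool) : Prop :=
  ∃ h : G, ((h, (c, true)) ∈ Ξ.edges ∧ p = (h, false) ∧ q = (h * φ c, false)) ∨
    ((h, (c, true)) ∈ Θ.edges ∧ p = rightLift φ Ξ Θ h ∧ q = rightLift φ Ξ Θ (h * φ c))

variable {φ Ξ Θ}

theorem joined_mul_iff {c : A} {h : G} (hΞ : (h, (c, true)) ∈ Ξ.edges)
    (hΘ : (h, (c, true)) ∈ Θ.edges) :
    (Ξ.inter Θ).Joined 1 (h * φ c) ↔ (Ξ.inter Θ).Joined 1 h := by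
  have he : (h, (c, true)) ∈ (Ξ.inter Θ).edges := ⟨hΞ, hΘ⟩
  exact ⟨fun hj => Subgraph.Joined.src (e := (h, (c, true))) hj he,
    fun hj => Subgraph.Joined.tgt (e := (h, (c, true))) hj he⟩

theorem rightLift_eq_iff {h h' : G} :
    (h', false) = rightLift φ Ξ Θ h ↔ h' = h ∧ (Ξ.inter Θ).Joined 1 h := by
  simp [rightLift]

theorem GluedEdge.fst_eq {c : A} {p q : G × Bool} (h : GluedEdge φ Ξ Θ c p q) :
    q.1 = p.1 * φ c := by
  obtain ⟨h, ⟨-, rfl, rfl⟩ | ⟨-, rfl, rfl⟩⟩ := h <;> rfl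

theorem GluedEdge.target_unique {c : A} {p q q' : G × Bool} (h : GluedEdge φ Ξ Θ c p q)
    (h' : GluedEdge φ Ξ Θ c p q') : q = q' := by
  obtain ⟨x, ⟨e, rfl, rfl⟩ | ⟨e, rfl, rfl⟩⟩ := h <;>
    obtain ⟨y, ⟨f, hxy, rfl⟩ | ⟨f, hxy, rfl⟩⟩ := h'
  · simp_all
  · obtain ⟨rfl, hj⟩ := rightLift_eq_iff.1 hxy
    exact rightLift_eq_iff.2 ⟨rfl, (joined_mul_iff e f).2 hj⟩
  · obtain ⟨rfl, hj⟩ := rightLift_eq_iff.1 hxy.symm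
    exact (rightLift_eq_iff.2 ⟨rfl, (joined_mul_iff f e).2 hj⟩).symm
  · obtain rfl : x = y := congrArg Prod.fst hxy
    rfl

theorem GluedEdge.source_unique {c : A} {p p' q : G × Bool} (h : GluedEdge φ Ξ Θ c p q)
    (h' : GluedEdge φ Ξ Θ c p' q) : p = p' := by
  have h1 : p.1 = p'.1 := mul_right_cancel (h.fst_eq.symm.trans h'.fst_eq)
  obtain ⟨x, ⟨e, rfl, rfl⟩ | ⟨e, rfl, rfl⟩⟩ := h <;>
    obtain ⟨y, ⟨f, rfl, hxy⟩ | ⟨f, rfl, hxy⟩⟩ := h' <;>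
    obtain rfl : x = y := h1
  · rfl
  · exact rightLift_eq_iff.2 ⟨rfl, (joined_mul_iff e f).1 (rightLift_eq_iff.1 hxy).2⟩
  · exact (rightLift_eq_iff.2 ⟨rfl, (joined_mul_iff f e).1 (rightLift_eq_iff.1 hxy.symm).2⟩).symm
  · rfl

theorem gluedEdge_left {c : A} {h : G} (e : (h, (c, true)) ∈ Ξ.edges) :
    GluedEdge φ Ξ Θ c (h, false) (h * φ c, false) := ⟨h, .inl ⟨e, rfl, rfl⟩⟩

theorem gluedEdge_right {c : A} {h : G} (e : (h, (c, true)) ∈ Θ.edges) :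
    GluedEdge φ Ξ Θ c (rightLift φ Ξ Θ h) (rightLift φ Ξ Θ (h * φ c)) := ⟨h, .inr ⟨e, rfl, rfl⟩⟩

theorem edge_inv_mem {Δ : (cayley φ).Subgraph} {h : G} {c : A}
    (e : (h, (c, false)) ∈ Δ.edges) : (h * (φ c)⁻¹, (c, true)) ∈ Δ.edges := by
  simpa [cayley, letter] using Δ.inv_mem _ e

/-- If the permutations `ψ c` (acting against the direction of the edges) extend the action of the
edges over a subgraph lifted along `l`, then words act as their paths prescribe. -/
theorem value_smul_lift {X : Type*} [MulAction H X] {ψ : A → H} {Δ : (cayley φ).Subgraph}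
    {l : G → X} (hl : ∀ h c, (h, (c, true)) ∈ Δ.edges → ψ c • l (h * φ c) = l h) :
    ∀ (w : List (A × Bool)) (h : G), (∀ e ∈ pathFrom φ h w, e ∈ Δ.edges) →
      (w.map (letter ψ)).prod • l (h * (w.map (letter φ)).prod) = l h
  | [], h, _ => by simp
  | (c, true) :: w, h, hw => by
    have ih := value_smul_lift hl w (h * φ c) (fun e he => hw e (List.mem_cons_of_mem _ he))
    have := hl h c (hw _ List.mem_cons_self)
    simp only [List.map_cons, List.prod_cons, mul_smul, letter, cond_true] at ih ⊢
    rw [← mul_assoc, ih, this]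
  | (c, false) :: w, h, hw => by
    have ih := value_smul_lift hl w (h * (φ c)⁻¹) (fun e he => hw e (List.mem_cons_of_mem _ he))
    have := hl _ c (edge_inv_mem (hw _ List.mem_cons_self))
    simp only [List.map_cons, List.prod_cons, mul_smul, letter, cond_false] at ih ⊢
    rw [← mul_assoc, ih, inv_smul_eq_iff, ← this, inv_mul_cancel_right]

/-- A set of vertices which contains with each vertex in the sheet the neighbouring ones contains
the end points of all paths. -/
theorem lift_mem_of_isPath {X : Type*} {Δ : (cayley φ).Subgraph} {l : G → X} {S : Set X}
    (hl : ∀ h c, (h, (c, true)) ∈ Δ.edges → (l (h * φ c) ∈ S ↔ l h ∈ S)) :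
    ∀ (p : List (G × (A × Bool))) (h g : G), (cayley φ).IsPath h p g → (∀ e ∈ p, e ∈ Δ.edges) →
      l h ∈ S → l g ∈ S
  | [], h, g, hp, _, hS => by
    obtain rfl : h = g := hp
    exact hS
  | (x, (c, true)) :: p, h, g, hp, hw, hS => by
    obtain ⟨rfl, hp⟩ := hp
    exact lift_mem_of_isPath hl p _ g hp (fun e he => hw e (List.mem_cons_of_mem _ he))
      ((hl x c (hw _ List.mem_cons_self)).2 hS)
  | (x, (c, false)) :: p, h, g, hp, hw, hS => by
    obtain ⟨rfl, hp⟩ := hp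
    refine lift_mem_of_isPath hl p _ g hp (fun e he => hw e (List.mem_cons_of_mem _ he)) ?_
    refine (hl (x * (φ c)⁻¹) c (edge_inv_mem (hw _ List.mem_cons_self))).1 ?_
    rw [inv_mul_cancel_right]
    exact hS

/-- The glued graph of a constellation has no nonempty set of vertices over which it is a covering
of the Cayley graph. -/
theorem eq_empty_of_closed_of_isConstellation [Nonempty A] [Finite G] (hφ : IsGenerated φ) {g : G}
    (hc : (cayley φ).IsConstellation 1 Ξ g Θ) (S : Set (G × Bool))
    (hS : ∀ c, ∀ q ∈ S, ∃ p ∈ S, GluedEdge φ Ξ Θ c p q) : S = ∅ := by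
  by_contra hne
  obtain ⟨q₀, hq₀⟩ := Set.nonempty_iff_ne_empty.2 hne
  -- Choosing predecessors is an injective self-map of the finite set `S`, hence surjective, so
  -- successors exist in `S` as well.
  have hS' : ∀ c, ∀ p ∈ S, ∃ q ∈ S, GluedEdge φ Ξ Θ c p q := by
    intro c
    choose f hfS hf using hS c
    let F : S → S := fun q => ⟨f q q.2, hfS q q.2⟩
    have hF : Function.Injective F := by
      intro q q' h
      have h1 := hf q q.2
      have h2 := hf q' q'.2
      rw [show f q q.2 = f q' q'.2 from congrArg Subtype.val h] at h1
      exact Subtype.ext (h1.target_unique h2)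
    intro p hp
    obtain ⟨q, hq⟩ := (Finite.injective_iff_surjective.1 hF) ⟨p, hp⟩
    refine ⟨q, q.2, ?_⟩
    have := hf q q.2
    rwa [show f q q.2 = p from congrArg Subtype.val hq] at this
  have hiff : ∀ c p q, GluedEdge φ Ξ Θ c p q → (q ∈ S ↔ p ∈ S) := by
    intro c p q h
    constructor
    · intro hq
      obtain ⟨p', hp', h'⟩ := hS c q hq
      rwa [h.source_unique h']
    · intro hp
      obtain ⟨q', hq', h'⟩ := hS' c p hp
      rwa [h.target_unique h']
  have hone : (Ξ.inter Θ).Joined 1 1 := ⟨hc.base_mem, hc.base_mem, [], rfl, by simp⟩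
  have hbase : rightLift φ Ξ Θ 1 = (1, false) := (rightLift_eq_iff.2 ⟨rfl, hone⟩).symm
  -- No edge starts at `(1, true)`, since the two sheets are glued at `1`.
  have hfib1 : ∀ q ∈ S, q.1 = 1 → q = (1, false) := by
    intro q hq hq1
    obtain ⟨c⟩ := ‹Nonempty A›
    obtain ⟨p, hp, h⟩ := hS' c q hq
    obtain ⟨h, ⟨-, rfl, rfl⟩ | ⟨-, rfl, rfl⟩⟩ := h
    · exact Prod.ext hq1 rfl
    · obtain rfl : h = 1 := hq1
      exact hbase
  have hreach : ∀ x : G, ∃ q ∈ S, q.1 = q₀.1 * x := by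
    intro x
    induction x using induction_on_mul hφ with
    | one => exact ⟨q₀, hq₀, by simp⟩
    | mul x c ih =>
      obtain ⟨q, hq, hqx⟩ := ih
      obtain ⟨p, hp, h⟩ := hS' c q hq
      exact ⟨p, hp, by rw [h.fst_eq, hqx, mul_assoc]⟩
    | mul_inv x c ih =>
      obtain ⟨q, hq, hqx⟩ := ih
      obtain ⟨p, hp, h⟩ := hS c q hq
      exact ⟨p, hp, by rw [← mul_assoc, eq_mul_inv_iff_mul_eq, ← h.fst_eq, hqx]⟩
  -- Edges carry fibres of `S` bijectively to one another, so every fibre has at most one point,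
  -- like the fibre over `1`.
  have hfib : ∀ x : G, ∀ q ∈ S, ∀ q' ∈ S, q.1 = x → q'.1 = x → q = q' := by
    intro x
    induction x using induction_on_mul hφ with
    | one => exact fun q hq q' hq' h h' => (hfib1 q hq h).trans (hfib1 q' hq' h').symm
    | mul x c ih =>
      intro q hq q' hq' h h'
      obtain ⟨p, hp, e⟩ := hS c q hq
      obtain ⟨p', hp', e'⟩ := hS c q' hq'
      have := ih p hp p' hp' (mul_right_cancel (e.fst_eq.symm.trans h))
        (mul_right_cancel (e'.fst_eq.symm.trans h'))
      exact e.target_unique (this ▸ e')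
    | mul_inv x c ih =>
      intro q hq q' hq' h h'
      obtain ⟨p, hp, e⟩ := hS' c q hq
      obtain ⟨p', hp', e'⟩ := hS' c q' hq'
      have := ih p hp p' hp' (by rw [e.fst_eq, h, inv_mul_cancel_right])
        (by rw [e'.fst_eq, h', inv_mul_cancel_right])
      exact e.source_unique (this ▸ e')
  have hbaseS : (1, false) ∈ S := by
    obtain ⟨q, hq, hq1⟩ := hreach q₀.1⁻¹
    rw [mul_inv_cancel] at hq1
    rwa [← hfib1 q hq hq1]
  obtain ⟨-, -, p, hp, hpe⟩ := hc.left_connected 1 hc.base_mem.1 g hc.vertex_mem.1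
  obtain ⟨-, -, p', hp', hpe'⟩ := hc.right_connected 1 hc.base_mem.2 g hc.vertex_mem.2
  have hgl : (g, false) ∈ S := lift_mem_of_isPath (l := fun h => (h, false))
    (fun h c e => hiff c _ _ (gluedEdge_left e)) p 1 g hp hpe hbaseS
  have hgr : rightLift φ Ξ Θ g ∈ S := lift_mem_of_isPath (l := rightLift φ Ξ Θ)
    (fun h c e => hiff c _ _ (gluedEdge_right e)) p' 1 g hp' hpe' (hbase ▸ hbaseS)
  exact hc.not_joined (rightLift_eq_iff.1 (hfib g _ hgl _ hgr rfl rfl)).2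

/-- A group acting on a set which contains the glued graph of a constellation, so that letters act
along the inverses of the edges, dissolves the constellation. -/
theorem dissolves_of_isConstellation {X : Type*} [MulAction H X] {ψ : A → H} {g : G}
    (hc : (cayley φ).IsConstellation 1 Ξ g Θ) (ι : G × Bool → X) (hι : Function.Injective ι)
    (h : ∀ c p q, GluedEdge φ Ξ Θ c p q → ψ c • ι q = ι p) : Dissolves φ ψ Ξ g Θ := by
  classical
  intro u v hu hv huΞ hvΘ huv
  have hone : (Ξ.inter Θ).Joined 1 1 := ⟨hc.base_mem, hc.base_mem, [], rfl, by simp⟩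
  have hbase : rightLift φ Ξ Θ 1 = (1, false) := (rightLift_eq_iff.2 ⟨rfl, hone⟩).symm
  have h1 := value_smul_lift (l := fun h => ι (h, false))
    (fun x c e => h c _ _ (gluedEdge_left e)) u.toWord 1 (by convert huΞ.2)
  have h2 := value_smul_lift (l := fun h => ι (rightLift φ Ξ Θ h))
    (fun x c e => h c _ _ (gluedEdge_right e)) v.toWord 1 (by convert hvΘ.2)
  simp only [← value_eq_prod, hu, hv, one_mul, hbase] at h1 h2
  rw [huv, ← h2, smul_left_cancel_iff] at h1
  exact hc.not_joined (rightLift_eq_iff.1 (hι h1)).2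

end Gluing

/-- For all large `m` there is a predissolver which is an alternating group of degree `m`. -/
theorem exists_alternatingGroup_isPredissolver [Finite A] [Nontrivial A] [Finite G] {φ : A → G}
    (hφ : IsGenerated φ) :
    ∃ N : ℕ, ∀ m, N ≤ m → ∃ ψ : A → alternatingGroup (Fin m), IsPredissolver φ ψ := by
  let K := {t : (cayley φ).Subgraph × G × (cayley φ).Subgraph //
    (cayley φ).IsConstellation 1 t.1 t.2.1 t.2.2}
  -- The edges are reversed because permutations compose from right to left: the last letter of a
  -- word acts first, so a word leads from the end of its path back to the start.
  let R : A → K × (G × Bool) → K × (G × Bool) → Prop := fun c x y =>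
    x.1 = y.1 ∧ GluedEdge φ x.1.1.1 x.1.1.2.2 c y.2 x.2
  obtain ⟨N, hN⟩ := AlternatingExtension.exists_generating_extension R
    (by
      rintro c ⟨k, q⟩ ⟨_, p⟩ ⟨_, p'⟩ ⟨rfl, h⟩ ⟨rfl, h'⟩
      exact Prod.ext rfl (h.source_unique h'))
    (by
      rintro c ⟨k, q⟩ ⟨k', q'⟩ ⟨_, p⟩ ⟨rfl, h⟩ ⟨rfl, h'⟩
      exact Prod.ext rfl (h.target_unique h'))
    (by
      intro S hS
      rw [Set.eq_empty_iff_forall_notMem]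
      rintro ⟨k, q⟩ hq
      have := eq_empty_of_closed_of_isConstellation hφ k.2 {q | (k, q) ∈ S} (by
        intro c q hq
        obtain ⟨⟨_, p⟩, hp, rfl, h⟩ := hS c _ hq
        exact ⟨p, hp, h⟩)
      exact (Set.eq_empty_iff_forall_notMem.1 this) q hq)
  refine ⟨N, fun m hm => ?_⟩
  obtain ⟨ι, ψ, hι, hψ, hR⟩ := hN m hm
  refine ⟨ψ, hψ, fun Ξ g Θ hc => ?_⟩
  exact dissolves_of_isConstellation (X := Fin m) hc (fun q => ι (⟨(Ξ, g, Θ), hc⟩, q))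
    (fun q q' h => congrArg Prod.snd (hι h)) (fun c p q h => hR c _ _ ⟨rfl, h⟩)

end AGenerated

/-! ### The product with `G` and its kernel -/

namespace AGenerated

open Equiv

variable {A G H : Type*} [Group G] [Group H]

theorem isGenerated_prodMap (ψ : A → H) (φ : A → G) : IsGenerated (prodMap ψ φ) := by
  apply Subgroup.map_injective (prod ψ φ).subtype_injective
  rw [MonoidHom.map_closure, ← Set.range_comp, ← MonoidHom.range_eq_map, Subgroup.range_subtype]
  rfl

theorem prodSnd_surjective (ψ : A → H) {φ : A → G} (hφ : IsGenerated φ) :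
    Function.Surjective (prodSnd ψ φ) := by
  rw [← MonoidHom.range_eq_top, eq_top_iff, ← hφ, Subgroup.closure_le]
  rintro _ ⟨a, rfl⟩
  exact ⟨prodMap ψ φ a, rfl⟩

theorem prodFst_surjective {ψ : A → H} (hψ : IsGenerated ψ) (φ : A → G) :
    Function.Surjective ((MonoidHom.fst H G).comp (prod ψ φ).subtype) := by
  rw [← MonoidHom.range_eq_top, eq_top_iff, ← hψ, Subgroup.closure_le]
  rintro _ ⟨a, rfl⟩
  exact ⟨prodMap ψ φ a, rfl⟩

theorem IsPredissolver.isDissolver_prodMap {ψ : A → H} {φ : A → G} (h : IsPredissolver φ ψ) :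
    IsDissolver φ (prodMap ψ φ) := by
  refine ⟨⟨isGenerated_prodMap ψ φ, ?_⟩, prodSnd ψ φ, fun a => rfl⟩
  intro Ξ g Θ hc u v hu hv huΞ hvΘ huv
  refine h.2 Ξ g Θ hc u v hu hv huΞ hvΘ ?_
  have key : ∀ w : FreeGroup A,
      ((MonoidHom.fst H G).comp (prod ψ φ).subtype) (value (prodMap ψ φ) w) = value ψ w := by
    intro w
    have : ((MonoidHom.fst H G).comp (prod ψ φ).subtype).comp (FreeGroup.lift (prodMap ψ φ)) =
        FreeGroup.lift ψ := by
      ext a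
      simp [prodMap]
    exact DFunLike.congr_fun this w
  rw [← key u, ← key v, huv]

/-- If `H` is simple and has more elements than `G`, then the kernel of the projection of the
product of `H` and `G` onto `G` is all of `H`. -/
theorem map_ker_prodSnd [IsSimpleGroup H] [Finite G] {ψ : A → H} (hψ : IsGenerated ψ)
    (φ : A → G) (hcard : Nat.card G < Nat.card H) :
    (prodSnd ψ φ).ker.map (prod ψ φ).subtype = (⊤ : Subgroup H).prod (⊥ : Subgroup G) := by
  have hsurj := prodFst_surjective hψ φ
  set π := (MonoidHom.fst H G).comp (prod ψ φ).subtype with hπ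
  have hnormal : ((prodSnd ψ φ).ker.map π).Normal := (prodSnd ψ φ).normal_ker.map π hsurj
  rcases hnormal.eq_bot_or_eq_top with hbot | htop
  -- A trivial image would make the projection to `G` injective, giving |H| ≤ |H ×_A G| ≤ |G|.
  · exfalso
    have hinj : Function.Injective (prodSnd ψ φ) := by
      rw [injective_iff_map_eq_one]
      intro x hx
      have : π x = 1 := by
        rw [← Subgroup.mem_bot, ← hbot]
        exact ⟨x, hx, rfl⟩
      exact Subtype.ext (Prod.ext this hx)
    have : Finite (prod ψ φ) := Finite.of_injective _ hinj
    have h1 := Nat.card_le_card_of_injective _ hinj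
    have h2 := Nat.card_le_card_of_surjective _ hsurj
    lia
  · ext ⟨x, y⟩
    simp only [Subgroup.mem_map, Subgroup.mem_prod, Subgroup.mem_top, true_and, Subgroup.mem_bot]
    constructor
    · rintro ⟨z, hz, hzxy⟩
      rw [← show (z : H × G).2 = y from congrArg Prod.snd hzxy]
      exact hz
    · rintro rfl
      obtain ⟨z, hz, hzx⟩ : x ∈ (prodSnd ψ φ).ker.map π := htop ▸ Subgroup.mem_top x
      exact ⟨z, hz, Prod.ext hzx hz⟩

theorem nonempty_ker_prodSnd_mulEquiv {ψ : A → H} {φ : A → G}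
    (h : (prodSnd ψ φ).ker.map (prod ψ φ).subtype = (⊤ : Subgroup H).prod (⊥ : Subgroup G)) :
    Nonempty ((prodSnd ψ φ).ker ≃* H) := by
  let π : (prodSnd ψ φ).ker →* H :=
    ((MonoidHom.fst H G).comp (prod ψ φ).subtype).comp (prodSnd ψ φ).ker.subtype
  refine ⟨MulEquiv.ofBijective π ⟨?_, ?_⟩⟩
  · intro x y hxy
    have hx : (x : H × G).2 = 1 := x.2
    have hy : (y : H × G).2 = 1 := y.2
    exact Subtype.ext (Subtype.ext (Prod.ext hxy (hx.trans hy.symm)))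
  · intro x
    have : (x, (1 : G)) ∈ (prodSnd ψ φ).ker.map (prod ψ φ).subtype := by
      rw [h]; simp [Subgroup.mem_prod]
    obtain ⟨z, hz, hzx⟩ := this
    exact ⟨⟨z, hz⟩, congrArg Prod.fst hzx⟩

theorem lt_card_alternatingGroup {m : ℕ} (hm : 5 ≤ m) :
    m < Nat.card (alternatingGroup (Fin m)) := by
  have : Nontrivial (Fin m) := Fin.nontrivial_iff_two_le.2 (by lia)
  have h := two_mul_nat_card_alternatingGroup (α := Fin m)
  rw [Nat.card_perm, Nat.card_eq_fintype_card (α := Fin m), Fintype.card_fin] at h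
  have h2 : m * (m - 1) ≤ m.factorial := by
    obtain ⟨j, rfl⟩ : ∃ j, m = j + 1 := ⟨m - 1, by lia⟩
    rw [Nat.factorial_succ, Nat.add_sub_cancel]
    exact Nat.mul_le_mul_left _ j.self_le_factorial
  have h3 : m * 4 ≤ m * (m - 1) := Nat.mul_le_mul_left _ (by lia)
  lia

theorem exists_alternatingGroup_two_generators :
    ∃ N : ℕ, ∀ m, N ≤ m → ∃ x y : alternatingGroup (Fin m), Subgroup.closure {x, y} = ⊤ := by
  -- With nothing to extend, the construction over a two-letter alphabet just yields two generators.
  obtain ⟨N, hN⟩ := AlternatingExtension.exists_generating_extension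
    (fun (_ : Bool) (_ _ : Empty) => False) (by simp) (by simp)
    (fun S _ => Set.eq_empty_of_isEmpty S)
  refine ⟨N, fun m hm => ?_⟩
  obtain ⟨-, ψ, -, hψ, -⟩ := hN m hm
  refine ⟨ψ false, ψ true, ?_⟩
  rwa [← Bool.range_eq]

end AGenerated

theorem mainTheorem4 {A : Type*} [Finite A] [Nontrivial A] {G : Type*} [Group G] [Finite G]
    (φ : A → G) (hφ : AGenerated.IsGenerated φ) :
    ∃ N : ℕ, Nat.card G ≤ N ∧ ∀ m : ℕ, N ≤ m →
      (∃ ψ : A → alternatingGroup (Fin m), AGenerated.IsPredissolver φ ψ) ∧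
      (∀ ψ : A → alternatingGroup (Fin m), AGenerated.IsPredissolver φ ψ →
        AGenerated.IsDissolver φ (AGenerated.prodMap ψ φ) ∧
        Function.Surjective (AGenerated.prodSnd ψ φ) ∧
        (AGenerated.prodSnd ψ φ).ker.map (AGenerated.prod ψ φ).subtype =
          (⊤ : Subgroup (alternatingGroup (Fin m))).prod (⊥ : Subgroup G) ∧
        Nonempty ((AGenerated.prodSnd ψ φ).ker ≃* alternatingGroup (Fin m))) ∧
      (∃ x y : alternatingGroup (Fin m), Subgroup.closure {x, y} = ⊤) := by
  obtain ⟨N₁, h₁⟩ := AGenerated.exists_alternatingGroup_isPredissolver hφ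
  obtain ⟨N₂, h₂⟩ := AGenerated.exists_alternatingGroup_two_generators
  -- The summand `5` gives simplicity of the alternating group and, with `Nat.card G`, an order
  -- larger than that of `G`.
  refine ⟨Nat.card G + N₁ + N₂ + 5, by lia, fun m hm => ⟨h₁ m (by lia), ?_, h₂ m (by lia)⟩⟩
  intro ψ hψ
  have : IsSimpleGroup (alternatingGroup (Fin m)) := alternatingGroup.isSimpleGroup (by simp; lia)
  have hcard := AGenerated.lt_card_alternatingGroup (m := m) (by lia)
  have hker := AGenerated.map_ker_prodSnd hψ.1 φ (by lia)
  exact ⟨hψ.isDissolver_prodMap, AGenerated.prodSnd_surjective ψ hφ, hker,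
    AGenerated.nonempty_ker_prodSnd_mulEquiv hker⟩
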